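/- Let $\mathbb H$ be the quaternions, $\partial\mathbb B=\{p\in\mathbb H:|p|=1\}$ and $n\in\mathbb N$. Let $F$ be a (slice hyperholomorphic) rational $n\times n$ matrix function, that is, $F(p)=r(p)^{-1}Q(p)$, where $Q(p)=\sum_k p^kQ_k$ is a polynomial with coefficients $Q_k\in\mathbb H^{n\times n}$ and $r\neq 0$ is a polynomial with real coefficients ($Q$ and $r$ may have common zeros). A point $p_0\in\mathbb H$ is called a pole of $F$ if $F$ has a non-removable singularity there, i.e. if $F(p)$ has no finite limit in $\mathbb H^{n\times n}$ as $p\to p_0$ within $\{p\in\mathbb H: r(p)\neq0\}$. Let $\mathcal W_{\mathbb H}^{n\times n}$ be the discrete Wiener algebra, i.e. the set of functions $G:\partial\mathbb B\to\mathbb H^{n\times n}$ of the form $G(p)=\sum_{u\in\mathbb Z}p^uG_u$ with $G_u\in\mathbb H^{n\times n}$ and $\sum_{u\in\mathbb Z}\|G_u\|_n<\infty$, where $\|\cdot\|_n$ is the operator norm with respect to the Euclidean norm on $\mathbb H^n$. Then $F$ has no poles on $\partial\mathbb B$ if and only if $F$ belongs to $\mathcal W_{\mathbb H}^{n\times n}$,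 in the sense that there is $G\in\mathcal W_{\mathbb H}^{n\times n}$ with $F(p)=G(p)$ for all $p\in\partial\mathbb B$ such that $r(p)\neq 0$. -/

import Mathlib

open scoped Quaternion Topology

noncomputable section

/-- The value at `p` of a polynomial with quaternionic coefficients written on the right,
`q(p) = ∑ pᵏ qₖ`. (`Polynomial.eval` would put the coefficients on the left.) The product of
`Polynomial ℍ[ℝ]`, in which the indeterminate is central, is the `⋆`-product. -/
def quatPolyEval (p : ℍ[ℝ]) (q : Polynomial ℍ[ℝ]) : ℍ[ℝ] :=
  q.sum fun k a => p ^ k * a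

/-- A slice hyperholomorphic rational `n × n` matrix function `F(p) = r(p)⁻¹ Q(p)`: here `Q` is a
polynomial matrix function with quaternionic coefficients and `r ≠ 0` is a polynomial with real
coefficients. The fraction need not be reduced. -/
structure QuatRationalMatrix (n : ℕ) where
  /-- the numerator `Q` -/
  num : Matrix (Fin n) (Fin n) (Polynomial ℍ[ℝ])
  /-- the denominator `r` -/
  den : Polynomial ℝ
  den_ne_zero : den ≠ 0

namespace QuatRationalMatrix

variable {n : ℕ}

/-- The quaternions at which the expression `r(p)⁻¹ Q(p)` is defined. -/
def domain (F : QuatRationalMatrix n) : Set ℍ[ℝ] :=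
  {p | Polynomial.aeval p F.den ≠ 0}

/-- The value `r(p)⁻¹ Q(p)`, meaningful for `p ∈ F.domain`. -/
def eval (F : QuatRationalMatrix n) (p : ℍ[ℝ]) : Matrix (Fin n) (Fin n) ℍ[ℝ] :=
  (Polynomial.aeval p F.den)⁻¹ • F.num.map (quatPolyEval p)

/-- `p₀` is a pole of `F`: a singularity that is not removable, that is, `F(p)` has no (finite)
limit as `p` tends to `p₀` through the quaternions at which `r(p)⁻¹ Q(p)` is defined. A common zero
of numerator and denominator is thus not automatically a pole. -/
def IsPole (F : QuatRationalMatrix n) (p₀ : ℍ[ℝ]) : Prop :=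
  ¬ ∃ L : Matrix (Fin n) (Fin n) ℍ[ℝ], Filter.Tendsto F.eval (𝓝[F.domain] p₀) (𝓝 L)

end QuatRationalMatrix

/-- A quaternionic matrix acting on the columns `ℍⁿ` with the Euclidean norm. -/
def quatMatrixCLM {n : ℕ} (A : Matrix (Fin n) (Fin n) ℍ[ℝ]) :
    EuclideanSpace ℍ[ℝ] (Fin n) →L[ℝ] EuclideanSpace ℍ[ℝ] (Fin n) :=
  LinearMap.toContinuousLinearMap
    { toFun := fun x => WithLp.toLp 2 (A.mulVec x.ofLp)
      map_add' := fun x y => by simp [Matrix.mulVec_add]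
      map_smul' := fun c x => by simp [Matrix.mulVec_smul] }

/-- The operator norm `‖·‖ₙ` of `ℍⁿˣⁿ` for the Euclidean norm of `ℍⁿ`. -/
def quatMatrixOpNorm {n : ℕ} (A : Matrix (Fin n) (Fin n) ℍ[ℝ]) : ℝ :=
  ‖quatMatrixCLM A‖

/-- The discrete quaternionic Wiener algebra (as a set): the matrix functions on the unit sphere
`∂𝔹 = {p : |p| = 1}` of the form `∑_{u ∈ ℤ} pᵘ F_u` with `∑ ‖F_u‖ₙ < ∞`. -/
def quatWiener (n : ℕ) :
    Set (Metric.sphere (0 : ℍ[ℝ]) 1 → Matrix (Fin n) (Fin n) ℍ[ℝ]) :=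
  {G | ∃ c : ℤ → Matrix (Fin n) (Fin n) ℍ[ℝ],
    (Summable fun u => quatMatrixOpNorm (c u)) ∧
      ∀ p : Metric.sphere (0 : ℍ[ℝ]) 1, HasSum (fun u => (p : ℍ[ℝ]) ^ u • c u) (G p)}

/-- `F` belongs to the Wiener algebra: on the part of the unit sphere where `r(p)⁻¹ Q(p)` is
defined (a dense open part), it coincides with an element of the Wiener algebra. -/
def QuatRationalMatrix.MemWiener {n : ℕ} (F : QuatRationalMatrix n) : Prop :=
  ∃ G ∈ quatWiener n, ∀ p : Metric.sphere (0 : ℍ[ℝ]) 1, (p : ℍ[ℝ]) ∈ F.domain → F.eval p = G p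

end

/-! The point is that a fraction with limits at all points of the sphere can be reduced until its
denominator has no zeros there (`exists_reduced`). At a zero `p₀` of `r`, a finite limit forces
`Q(p₀) = 0`; the same holds at `star p₀`, because `r` is real. These two zeros make the real minimal
polynomial of `p₀` divide `Q`, so it cancels. Without poles, `1/r` then has an absolutely summable
Laurent series with real coefficients on the unit circle. It carries over to every slice of `ℍ`, and
multiplying by `Q` gives the Wiener expansion (`eval_mem_quatWiener`). Conversely, a Wiener function
is continuous on the sphere, so `F` has limits along the sphere. That is enough for the reduction,
and the reduced fraction is continuous at each point of the sphere. -/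

/-! ### Absolutely convergent Laurent series on the unit circle -/

/-- On the unit circle, `f` is the sum of an absolutely convergent Laurent series. -/
def IsAbsLaurent (f : ℂ → ℂ) : Prop :=
  ∃ c : ℤ → ℂ, (Summable fun u => ‖c u‖) ∧
    ∀ z : ℂ, ‖z‖ = 1 → HasSum (fun u => c u * z ^ u) (f z)

theorem HasSum.congr_eq {ι E : Type*} [AddCommMonoid E] [TopologicalSpace E] {f g : ι → E} {a b : E}
    (h : HasSum f a) (hfg : ∀ i, g i = f i) (hab : b = a) : HasSum g b := by
  rw [hab, funext hfg]
  exact h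

theorem IsAbsLaurent.of_injective {f : ℂ → ℂ} {g : ℕ → ℤ} (hg : Function.Injective g)
    {b : ℕ → ℂ} (hb : Summable fun k => ‖b k‖)
    (h : ∀ z : ℂ, ‖z‖ = 1 → HasSum (fun k => b k * z ^ g k) (f z)) : IsAbsLaurent f := by
  refine ⟨Function.extend g b 0, ?_, fun z hz => ?_⟩
  · refine (hg.summable_iff ?_).1 ?_
    · intro x hx
      rw [Function.extend_apply' _ _ _ (by simpa using hx)]
      simp
    · simpa [Function.comp_def, hg.extend_apply] using hb
  · refine (hg.hasSum_iff ?_).1 ?_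
    · intro x hx
      rw [Function.extend_apply' _ _ _ (by simpa using hx)]
      simp
    · simpa [Function.comp_def, hg.extend_apply] using h z hz

theorem isAbsLaurent_const (a : ℂ) : IsAbsLaurent fun _ => a := by
  classical
  refine ⟨Pi.single 0 a, ?_, fun z _ => ?_⟩
  · refine summable_of_ne_finset_zero (s := {0}) fun u hu => ?_
    have : u ≠ 0 := by simpa using hu
    simp [this]
  · convert hasSum_single (0 : ℤ) ?_ using 1
    · simp
    · intro u hu
      simp [hu]

/-- Geometric series in `α / z` when `‖α‖ < 1`, in `z / α` when `‖α‖ > 1`. -/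
theorem isAbsLaurent_inv_sub {α : ℂ} (hα : ‖α‖ ≠ 1) : IsAbsLaurent fun z => (z - α)⁻¹ := by
  rcases lt_or_gt_of_ne hα with h | h
  · refine IsAbsLaurent.of_injective (g := fun k => -((k : ℤ) + 1)) (b := fun k => α ^ k)
      (fun a b hab => by simpa using hab) ?_ fun z hz => ?_
    · simpa using summable_geometric_of_lt_one (norm_nonneg α) h
    · have hz0 : z ≠ 0 := by rintro rfl; simp at hz
      have hs : ‖α / z‖ < 1 := by simpa [hz] using h
      refine ((hasSum_geometric_of_norm_lt_one hs).mul_left z⁻¹).congr_eq (fun k => ?_) ?_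
      · rw [zpow_neg, zpow_add₀ hz0, zpow_natCast, zpow_one, div_pow]
        field_simp
      · rw [← mul_inv, mul_sub, mul_div_cancel₀ _ hz0, mul_one]
  · have hα0 : α ≠ 0 := by rintro rfl; simp at h; linarith
    refine IsAbsLaurent.of_injective (g := fun k => (k : ℤ)) (b := fun k => -α⁻¹ * (α⁻¹) ^ k)
      (fun a b hab => by simpa using hab) ?_ fun z hz => ?_
    · simpa using (summable_geometric_of_lt_one (inv_nonneg.2 (norm_nonneg α))
        (inv_lt_one_of_one_lt₀ h)).mul_left ‖α‖⁻¹
    · have hs : ‖z / α‖ < 1 := by simpa [hz] using inv_lt_one_of_one_lt₀ h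
      refine ((hasSum_geometric_of_norm_lt_one hs).mul_left (-α⁻¹)).congr_eq (fun k => ?_) ?_
      · rw [zpow_natCast, div_pow, inv_pow]
        ring
      · rw [neg_mul, ← mul_inv, mul_sub, mul_div_cancel₀ _ hα0, mul_one, ← neg_sub α z, inv_neg]

theorem IsAbsLaurent.mul {f g : ℂ → ℂ} (hf : IsAbsLaurent f) (hg : IsAbsLaurent g) :
    IsAbsLaurent fun z => f z * g z := by
  obtain ⟨c, hc, hfc⟩ := hf
  obtain ⟨d, hd, hgd⟩ := hg
  -- Sends (total exponent, first exponent) to the pair of exponents, so that summing over fibres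
  -- gives the Cauchy product.
  let e : ℤ × ℤ ≃ ℤ × ℤ :=
    { toFun := fun x => (x.2, x.1 - x.2)
      invFun := fun y => (y.1 + y.2, y.1)
      left_inv := fun x => by simp
      right_inv := fun y => by simp }
  have hsum : Summable fun x : ℤ × ℤ => ‖c x.2 * d (x.1 - x.2)‖ :=
    by
    have h := hc.mul_norm hd
    exact (e.summable_iff (f := fun y : ℤ × ℤ => ‖c y.1 * d y.2‖)).2 h
  refine ⟨fun u => ∑' v, c v * d (u - v), ?_, fun z hz => ?_⟩
  · refine Summable.of_nonneg_of_le (fun _ => norm_nonneg _) (fun u => ?_) hsum.prod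
    exact norm_tsum_le_tsum_norm (hsum.prod_factor u)
  · have hz0 : z ≠ 0 := by rintro rfl; simp at hz
    have hF := hfc z hz
    have hG := hgd z hz
    have hFn : Summable fun v => ‖c v * z ^ v‖ := by simpa [norm_zpow, hz] using hc
    have hGn : Summable fun v => ‖d v * z ^ v‖ := by simpa [norm_zpow, hz] using hd
    have h1 := (summable_mul_of_summable_norm hFn hGn).hasSum
    rw [← tsum_mul_tsum_of_summable_norm hFn hGn, hF.tsum_eq, hG.tsum_eq] at h1
    have h2 := (e.hasSum_iff (f := fun y : ℤ × ℤ => (c y.1 * z ^ y.1) * (d y.2 * z ^ y.2))).2 h1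
    refine h2.prod_fiberwise fun u => ?_
    have h3 : Summable fun v => c v * d (u - v) := (hsum.prod_factor u).of_norm
    refine (h3.hasSum.mul_right (z ^ u)).congr_eq (fun v => ?_) rfl
    simp only [e, Function.comp_apply, Equiv.coe_fn_mk]
    rw [zpow_sub₀ hz0]
    field_simp

theorem isAbsLaurent_inv_eval {p : Polynomial ℂ} (hp : ∀ z : ℂ, ‖z‖ = 1 → p.eval z ≠ 0) :
    IsAbsLaurent fun z => (p.eval z)⁻¹ := by
  have hp0 : p ≠ 0 := by rintro rfl; exact hp 1 (by simp) (by simp)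
  have hprod : ∀ s : Multiset ℂ, (∀ α ∈ s, ‖α‖ ≠ 1) →
      IsAbsLaurent fun z => ((s.map fun α => z - α).prod)⁻¹ := by
    intro s
    induction s using Multiset.induction_on with
    | empty => intro _; simpa using isAbsLaurent_const 1
    | cons a s ih =>
      intro hs
      have h := (isAbsLaurent_inv_sub (hs a (by simp))).mul
        (ih fun α hα => hs α (Multiset.mem_cons_of_mem hα))
      simpa [mul_comm] using h
  have h := (isAbsLaurent_const p.leadingCoeff⁻¹).mul (hprod p.roots fun α hα hn =>
    hp α hn ((Polynomial.mem_roots hp0).1 hα))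
  convert h using 2 with z
  rw [(IsAlgClosed.splits p).eval_eq_prod_roots, mul_inv]

/-- Real coefficients commute with every quaternion. They arise by averaging the series at `z` with
the conjugate of the series at the conjugate of `z`, which have the same sum since `r` is real. -/
theorem exists_real_laurent_inv_aeval {r : Polynomial ℝ}
    (hr : ∀ z : ℂ, ‖z‖ = 1 → Polynomial.aeval z r ≠ 0) :
    ∃ c : ℤ → ℝ, (Summable fun u => |c u|) ∧
      ∀ z : ℂ, ‖z‖ = 1 → HasSum (fun u => c u • z ^ u) (Polynomial.aeval z r)⁻¹ := by
  obtain ⟨c, hc, h⟩ := isAbsLaurent_inv_eval (p := r.map (algebraMap ℝ ℂ))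
    (fun z hz => by simpa [Polynomial.eval_map_algebraMap] using hr z hz)
  simp only [Polynomial.eval_map_algebraMap] at h
  refine ⟨fun u => (c u).re, ?_, fun z hz => ?_⟩
  · exact Summable.of_nonneg_of_le (fun _ => abs_nonneg _) (fun u => Complex.abs_re_le_norm _) hc
  · have h1 := h z hz
    have h2 := Complex.hasSum_conj'.2 (h (starRingEnd ℂ z) (by simpa using hz))
    have h3 := (h1.add h2).mul_left (1 / 2 : ℂ)
    refine h3.congr_eq (fun u => ?_) ?_
    · have := Complex.re_eq_add_conj (c u)
      simp only [map_mul, map_zpow₀, Complex.conj_conj, Complex.real_smul, this]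
      ring
    · rw [Polynomial.aeval_conj, map_inv₀, Complex.conj_conj]
      ring

/-! ### Quaternionic polynomials, complex slices and divisibility -/

theorem quatPolyEval_add (p : ℍ[ℝ]) (q₁ q₂ : Polynomial ℍ[ℝ]) :
    quatPolyEval p (q₁ + q₂) = quatPolyEval p q₁ + quatPolyEval p q₂ :=
  Polynomial.sum_add_index q₁ q₂ _ (by simp) (by simp [mul_add])

theorem quatPolyEval_monomial (p : ℍ[ℝ]) (k : ℕ) (a : ℍ[ℝ]) :
    quatPolyEval p (Polynomial.monomial k a) = p ^ k * a :=
  Polynomial.sum_monomial_index _ _ (by simp)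

theorem quatPolyEval_C (p a : ℍ[ℝ]) : quatPolyEval p (Polynomial.C a) = a := by
  simpa using quatPolyEval_monomial p 0 a

theorem quatPolyEval_eq_sum_range (p : ℍ[ℝ]) {q : Polynomial ℍ[ℝ]} {N : ℕ}
    (h : q.natDegree < N) :
    quatPolyEval p q = ∑ k ∈ Finset.range N, p ^ k * q.coeff k :=
  Polynomial.sum_over_range' q (by simp) N h

theorem continuous_quatPolyEval (q : Polynomial ℍ[ℝ]) : Continuous fun p => quatPolyEval p q := by
  unfold quatPolyEval Polynomial.sum
  fun_prop

theorem quatPolyEval_map_mul (p : ℍ[ℝ]) (q : Polynomial ℝ) (s : Polynomial ℍ[ℝ]) :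
    quatPolyEval p (q.map (algebraMap ℝ ℍ[ℝ]) * s) =
      Polynomial.aeval p q * quatPolyEval p s := by
  induction q using Polynomial.induction_on' with
  | add q₁ q₂ h₁ h₂ => simp [add_mul, quatPolyEval_add, h₁, h₂]
  | monomial k a =>
    induction s using Polynomial.induction_on' with
    | add s₁ s₂ h₁ h₂ => rw [mul_add, quatPolyEval_add, h₁, h₂, quatPolyEval_add, mul_add]
    | monomial l b =>
      rw [Polynomial.map_monomial, Polynomial.monomial_mul_monomial, quatPolyEval_monomial,
        quatPolyEval_monomial, Polynomial.aeval_monomial, pow_add, Algebra.commutes a (p ^ k)]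
      simp only [mul_assoc]
      rw [← mul_assoc (p ^ l), ← Algebra.commutes a (p ^ l), mul_assoc]

/-- Every quaternion lies in an isometric copy of `ℂ`. -/
theorem exists_complex_algHom_quaternion (p : ℍ[ℝ]) :
    ∃ φ : ℂ →ₐ[ℝ] ℍ[ℝ], (∀ z, ‖φ z‖ = ‖z‖) ∧ ∃ z, φ z = p := by
  have key : ∃ x y w b : ℝ, x ^ 2 + y ^ 2 + w ^ 2 = 1 ∧
      p.imI = b * x ∧ p.imJ = b * y ∧ p.imK = b * w := by
    set b := √(p.imI ^ 2 + p.imJ ^ 2 + p.imK ^ 2) with hb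
    have hb2 : b ^ 2 = p.imI ^ 2 + p.imJ ^ 2 + p.imK ^ 2 := Real.sq_sqrt (by positivity)
    -- For real `p` any imaginary unit will do.
    by_cases h0 : b = 0
    · rw [h0] at hb2
      refine ⟨1, 0, 0, 0, by norm_num, ?_, ?_, ?_⟩ <;> nlinarith
    · refine ⟨p.imI / b, p.imJ / b, p.imK / b, b, ?_, ?_, ?_, ?_⟩ <;> field_simp
      exact hb2.symm
  obtain ⟨x, y, w, b, h1, hi, hj, hk⟩ := key
  obtain ⟨J, hr, hx, hy, hw⟩ : ∃ J : ℍ[ℝ], J.re = 0 ∧ J.imI = x ∧ J.imJ = y ∧ J.imK = w :=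
    ⟨⟨0, x, y, w⟩, rfl, rfl, rfl, rfl⟩
  have hJ : J * J = -1 := by
    ext <;> simp [hr, hx, hy, hw] <;> linarith
  refine ⟨Complex.liftAux J hJ, fun z => ?_, ⟨p.re, b⟩, ?_⟩
  · have h2 : ‖Complex.liftAux J hJ z‖ ^ 2 = ‖z‖ ^ 2 := by
      rw [sq, ← Quaternion.normSq_eq_norm_mul_self, ← Complex.normSq_eq_norm_sq,
        Complex.normSq_apply, Quaternion.normSq_def']
      simp [hr, hx, hy, hw, Complex.liftAux_apply]
      linear_combination z.im ^ 2 * h1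
    exact (sq_eq_sq₀ (norm_nonneg _) (norm_nonneg _)).1 h2
  · ext <;> simp [hr, hx, hy, hw, Complex.liftAux_apply, hi, hj, hk]

/-- In a slice through `p₀` the unit circle has no isolated points, while `r` has only finitely many
zeros. -/
theorem mem_closure_sphere_aeval_ne_zero {r : Polynomial ℝ} (hr : r ≠ 0) {p₀ : ℍ[ℝ]}
    (hp₀ : ‖p₀‖ = 1) :
    p₀ ∈ closure ({p | Polynomial.aeval p r ≠ 0} ∩ Metric.sphere (0 : ℍ[ℝ]) 1) := by
  obtain ⟨φ, hφ, z₀, rfl⟩ := exists_complex_algHom_quaternion p₀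
  rw [hφ] at hp₀
  have hacc : AccPt z₀ (Filter.principal (Metric.sphere (0 : ℂ) 1)) := by
    refine (isPreconnected_sphere (by simp) (0 : ℂ) 1).preperfect_of_nontrivial ?_ z₀ (by simpa)
    exact ⟨1, by simp, -1, by simp, by norm_num⟩
  have hroots : ∀ᶠ z in 𝓝[≠] z₀, Polynomial.aeval z r ≠ 0 := by
    have hfin : {z : ℂ | Polynomial.aeval z r = 0}.Finite := by
      refine (r.rootSet_finite ℂ).subset fun z hz => ?_
      exact (Polynomial.mem_rootSet).2 ⟨hr, hz⟩
    have := (hfin.subset (Set.sdiff_subset (t := {z₀}))).isClosed.isOpen_compl.mem_nhds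
      (x := z₀) (by simp)
    filter_upwards [mem_nhdsWithin_of_mem_nhds this, self_mem_nhdsWithin] with z h1 h2 h3
    exact h1 ⟨h3, h2⟩
  have hfreq : ∃ᶠ z in 𝓝[≠] z₀, z ∈ Metric.sphere (0 : ℂ) 1 := accPt_iff_frequently_nhdsNE.1 hacc
  have hcont : Filter.Tendsto φ (𝓝[≠] z₀) (𝓝 (φ z₀)) :=
    (φ.toLinearMap.continuous_of_finiteDimensional.tendsto z₀).mono_left nhdsWithin_le_nhds
  refine mem_closure_of_frequently_of_tendsto ((hfreq.and_eventually hroots).mono ?_) hcont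
  rintro z ⟨hz, hz'⟩
  refine ⟨?_, by simpa [hφ] using hz⟩
  simp only [Set.mem_ofPred_eq, Polynomial.aeval_algHom_apply]
  simpa using hz'

theorem Quaternion.aeval_star (p : ℍ[ℝ]) (r : Polynomial ℝ) :
    Polynomial.aeval (star p) r = star (Polynomial.aeval p r) := by
  simp [Polynomial.aeval_eq_sum_range]

theorem Quaternion.natDegree_minpoly_le_two (p : ℍ[ℝ]) : (minpoly ℝ p).natDegree ≤ 2 := by
  have hdvd : minpoly ℝ p ∣ Polynomial.C 1 * Polynomial.X ^ 2 + Polynomial.C (-2 * p.re) *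
      Polynomial.X + Polynomial.C (Quaternion.normSq p) := by
    refine minpoly.dvd ℝ p ?_
    simp only [map_one, one_mul, map_add, map_pow, Polynomial.aeval_X, map_mul, Polynomial.aeval_C]
    ext <;> simp [Quaternion.normSq_def', pow_two] <;> ring
  refine (Polynomial.natDegree_le_of_dvd hdvd fun h => ?_).trans Polynomial.natDegree_quadratic_le
  have := congrArg (fun q => Polynomial.coeff q 2) h
  simp at this

/-- The remainder modulo the minimal polynomial vanishes at `p` and `star p`. If `p` is not real it
has the form `x * a + b` with two distinct zeros, so it is zero; if `p` is real it is a constant. -/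
theorem exists_eq_map_minpoly_mul {p : ℍ[ℝ]} {s : Polynomial ℍ[ℝ]} (h : quatPolyEval p s = 0)
    (h' : quatPolyEval (star p) s = 0) :
    ∃ t, s = (minpoly ℝ p).map (algebraMap ℝ ℍ[ℝ]) * t := by
  have hint : IsIntegral ℝ p := Algebra.IsIntegral.isIntegral p
  set q := (minpoly ℝ p).map (algebraMap ℝ ℍ[ℝ]) with hq
  have hm : q.Monic := (minpoly.monic hint).map _
  have hdeg : q.natDegree = (minpoly ℝ p).natDegree := (minpoly.monic hint).natDegree_map _
  have hpos := minpoly.natDegree_pos hint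
  have hlt := Polynomial.natDegree_modByMonic_lt s hm (by rintro h1; simp [h1] at hdeg; omega)
  have hs := Polynomial.modByMonic_add_div s q
  have hz : ∀ x, Polynomial.aeval x (minpoly ℝ p) = 0 → quatPolyEval x s = 0 →
      quatPolyEval x (s %ₘ q) = 0 := by
    intro x hx hxs
    rw [← hs, quatPolyEval_add, hq, quatPolyEval_map_mul, hx, zero_mul, add_zero] at hxs
    exact hxs
  have h1 := hz p (minpoly.aeval ℝ p) h
  have h2 := hz (star p) (by rw [Quaternion.aeval_star, minpoly.aeval, star_zero]) h'
  have hR : s %ₘ q = 0 := by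
    by_cases hp : star p = p
    · have hpr : p = algebraMap ℝ ℍ[ℝ] p.re := by
        rw [Quaternion.star_eq_self] at hp
        exact hp
      have hd1 : (minpoly ℝ p).natDegree = 1 := by
        rw [hpr, minpoly.eq_X_sub_C, Polynomial.natDegree_X_sub_C]
      have h0 := Polynomial.eq_C_of_natDegree_eq_zero (p := s %ₘ q) (by omega)
      rw [h0, quatPolyEval_C] at h1
      rw [h0, h1, map_zero]
    · have hle := Quaternion.natDegree_minpoly_le_two p
      obtain ⟨a, b, hab⟩ := Polynomial.exists_eq_X_add_C_of_natDegree_le_one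
        (p := s %ₘ q) (by omega)
      have hev : ∀ x, quatPolyEval x (s %ₘ q) = x * a + b := by
        intro x
        rw [hab, quatPolyEval_add, quatPolyEval_C, ← pow_one Polynomial.X,
          Polynomial.C_mul_X_pow_eq_monomial, quatPolyEval_monomial, pow_one]
      rw [hev] at h1 h2
      have ha : a = 0 := by
        have h3 : (star p - p) * a = 0 := by
          rw [sub_mul, ← add_sub_add_right_eq_sub _ _ b, h1, h2, sub_zero]
        exact (mul_eq_zero.1 h3).resolve_left (sub_ne_zero.2 hp)
      have hb : b = 0 := by simpa [ha] using h1
      rw [hab, ha, hb]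
      simp
  refine ⟨s /ₘ q, ?_⟩
  rw [hR, zero_add] at hs
  exact hs.symm

/-! ### Cancelling the zeros of the denominator on the sphere -/

namespace QuatRationalMatrix

variable {n : ℕ}

theorem continuous_num_eval (F : QuatRationalMatrix n) :
    Continuous fun p => F.num.map (quatPolyEval p) :=
  continuous_matrix fun i j => continuous_quatPolyEval (F.num i j)

theorem continuous_den_eval (F : QuatRationalMatrix n) :
    Continuous fun p : ℍ[ℝ] => Polynomial.aeval p F.den :=
  F.den.continuous_aeval

theorem continuousAt_eval (F : QuatRationalMatrix n) {p : ℍ[ℝ]} (hp : p ∈ F.domain) :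
    ContinuousAt F.eval p :=
  (F.continuous_den_eval.continuousAt.inv₀ hp).smul F.continuous_num_eval.continuousAt

theorem den_smul_eval (F : QuatRationalMatrix n) {p : ℍ[ℝ]} (hp : p ∈ F.domain) :
    Polynomial.aeval p F.den • F.eval p = F.num.map (quatPolyEval p) :=
  smul_inv_smul₀ hp _

/-- Pass to the limit in `r F = Q` along `S`. -/
theorem num_eval_eq_zero (F : QuatRationalMatrix n) {S : Set ℍ[ℝ]} (hS : S ⊆ F.domain)
    {p₀ : ℍ[ℝ]} (hp₀ : p₀ ∈ closure S) {L : Matrix (Fin n) (Fin n) ℍ[ℝ]}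
    (hL : Filter.Tendsto F.eval (𝓝[S] p₀) (𝓝 L)) (h0 : Polynomial.aeval p₀ F.den = 0) :
    F.num.map (quatPolyEval p₀) = 0 := by
  have : (𝓝[S] p₀).NeBot := mem_closure_iff_nhdsWithin_neBot.1 hp₀
  have h1 := (F.continuous_den_eval.continuousWithinAt (s := S) (x := p₀)).tendsto.smul hL
  have h2 := (F.continuous_num_eval.continuousWithinAt (s := S) (x := p₀)).tendsto
  rw [h0, zero_smul] at h1
  refine tendsto_nhds_unique h2 (h1.congr' ?_)
  filter_upwards [self_mem_nhdsWithin] with p hp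
  exact F.den_smul_eval (hS hp)

/-- A rational matrix function having limits at all points of the unit sphere, along a set `S`,
can be reduced to a fraction whose denominator has no zeros on the unit sphere. -/
theorem exists_reduced (F : QuatRationalMatrix n) {S : Set ℍ[ℝ]} (hS : S ⊆ F.domain)
    (hcl : Metric.sphere 0 1 ⊆ closure S)
    (hlim : ∀ p₀ ∈ Metric.sphere (0 : ℍ[ℝ]) 1,
      ∃ L, Filter.Tendsto F.eval (𝓝[S] p₀) (𝓝 L)) :
    ∃ F' : QuatRationalMatrix n, Metric.sphere 0 1 ⊆ F'.domain ∧
      ∀ p ∈ F.domain, F.eval p = F'.eval p := by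
  induction hd : F.den.natDegree using Nat.strong_induction_on generalizing F with
  | _ d ih =>
  by_cases hall : Metric.sphere 0 1 ⊆ F.domain
  · exact ⟨F, hall, fun _ _ => rfl⟩
  obtain ⟨p₀, hp₀, hdom⟩ := Set.not_subset.1 hall
  have h0 : Polynomial.aeval p₀ F.den = 0 := not_not.1 hdom
  have hzero : ∀ x ∈ Metric.sphere (0 : ℍ[ℝ]) 1, Polynomial.aeval x F.den = 0 →
      ∀ i j, quatPolyEval x (F.num i j) = 0 := by
    intro x hx hx0 i j
    obtain ⟨L, hL⟩ := hlim x hx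
    exact congrFun (congrFun (F.num_eval_eq_zero hS (hcl hx) hL hx0) i) j
  have hstar : star p₀ ∈ Metric.sphere (0 : ℍ[ℝ]) 1 := by simpa using hp₀
  choose T hT using fun i j => exists_eq_map_minpoly_mul (hzero p₀ hp₀ h0 i j)
    (hzero (star p₀) hstar (by rw [Quaternion.aeval_star, h0, star_zero]) i j)
  obtain ⟨r, hr⟩ := minpoly.dvd ℝ p₀ h0
  have hr0 : r ≠ 0 := by
    rintro rfl
    exact F.den_ne_zero (by rw [hr, mul_zero])
  have hint : IsIntegral ℝ p₀ := Algebra.IsIntegral.isIntegral p₀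
  have hpos := minpoly.natDegree_pos hint
  let F₁ : QuatRationalMatrix n := ⟨Matrix.of T, r, hr0⟩
  have hdom₁ : ∀ p ∈ F.domain, Polynomial.aeval p (minpoly ℝ p₀) ≠ 0 ∧ p ∈ F₁.domain := by
    intro p hp
    have hp' : Polynomial.aeval p F.den ≠ 0 := hp
    rw [hr, map_mul] at hp'
    exact mul_ne_zero_iff.1 hp'
  have heq : ∀ p ∈ F.domain, F.eval p = F₁.eval p := by
    intro p hp
    ext1 i j
    have hi : (Polynomial.aeval p F.den)⁻¹ = (Polynomial.aeval p r)⁻¹ *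
        (Polynomial.aeval p (minpoly ℝ p₀))⁻¹ := by rw [hr, map_mul, mul_inv_rev]
    change (Polynomial.aeval p F.den)⁻¹ * quatPolyEval p (F.num i j) =
      (Polynomial.aeval p r)⁻¹ * quatPolyEval p (T i j)
    rw [hi, hT i j, quatPolyEval_map_mul, mul_assoc, inv_mul_cancel_left₀ (hdom₁ p hp).1]
  obtain ⟨F', h1, h2⟩ := ih r.natDegree (by
      rw [← hd, hr, Polynomial.natDegree_mul (minpoly.ne_zero hint) hr0]
      omega) F₁ (fun p hp => (hdom₁ p (hS hp)).2)
    (fun p hp => by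
      obtain ⟨L, hL⟩ := hlim p hp
      refine ⟨L, hL.congr' ?_⟩
      filter_upwards [self_mem_nhdsWithin] with x hx using heq x (hS hx)) rfl
  exact ⟨F', h1, fun p hp => (heq p hp).trans (h2 p (hdom₁ p hp).2)⟩

end QuatRationalMatrix

/-! ### Operator norm and Wiener expansion -/

theorem quatMatrixOpNorm_sum_smul_le {n : ℕ} {ι : Type*} (s : Finset ι) (a : ι → ℝ)
    (M : ι → Matrix (Fin n) (Fin n) ℍ[ℝ]) :
    quatMatrixOpNorm (∑ k ∈ s, a k • M k) ≤ ∑ k ∈ s, |a k| * quatMatrixOpNorm (M k) := by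
  have h : quatMatrixCLM (∑ k ∈ s, a k • M k) = ∑ k ∈ s, a k • quatMatrixCLM (M k) := by
    ext1 x
    simp [quatMatrixCLM, Matrix.sum_mulVec, Matrix.smul_mulVec]
  unfold quatMatrixOpNorm
  rw [h]
  refine (norm_sum_le s fun k => a k • quatMatrixCLM (M k)).trans_eq ?_
  exact Finset.sum_congr rfl fun k _ =>
    @norm_smul ℝ (EuclideanSpace ℍ[ℝ] (Fin n) →L[ℝ] EuclideanSpace ℍ[ℝ] (Fin n)) _ _ _
      (@NormedSpace.toNormSMulClass _ _ _ _ ContinuousLinearMap.toNormedSpace)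
      (a k) (quatMatrixCLM (M k))

theorem norm_apply_le_quatMatrixOpNorm {n : ℕ} (A : Matrix (Fin n) (Fin n) ℍ[ℝ]) (i j : Fin n) :
    ‖A i j‖ ≤ quatMatrixOpNorm A := by
  have h := (quatMatrixCLM A).le_opNorm (PiLp.single 2 j (1 : ℍ[ℝ]))
  rw [PiLp.norm_single, norm_one, mul_one] at h
  refine le_trans ?_ h
  have h2 := PiLp.norm_apply_le (quatMatrixCLM A (PiLp.single 2 j (1 : ℍ[ℝ]))) i
  simpa [quatMatrixCLM] using h2

namespace QuatRationalMatrix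

variable {n : ℕ}

theorem hasSum_inv_aeval_quaternion {r : Polynomial ℝ} {c : ℤ → ℝ}
    (hc : ∀ z : ℂ, ‖z‖ = 1 → HasSum (fun u => c u • z ^ u) (Polynomial.aeval z r)⁻¹)
    {p : ℍ[ℝ]} (hp : ‖p‖ = 1) : HasSum (fun u => c u • p ^ u) (Polynomial.aeval p r)⁻¹ := by
  obtain ⟨φ, hφ, z, rfl⟩ := exists_complex_algHom_quaternion p
  rw [hφ] at hp
  have h := (hc z hp).map φ φ.toLinearMap.continuous_of_finiteDimensional
  simpa [Function.comp_def, Polynomial.aeval_algHom_apply, -Complex.real_smul] using h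

theorem eval_mem_quatWiener (F : QuatRationalMatrix n)
    (hF : Metric.sphere 0 1 ⊆ F.domain) :
    (fun p : Metric.sphere (0 : ℍ[ℝ]) 1 => F.eval p) ∈ quatWiener n := by
  obtain ⟨c, hc, hcz⟩ := exists_real_laurent_inv_aeval (r := F.den) fun z hz h0 => by
    obtain ⟨φ, hφ, -⟩ := exists_complex_algHom_quaternion 0
    refine hF (a := φ z) (by simpa [hφ] using hz) ?_
    rw [Polynomial.aeval_algHom_apply, h0, map_zero]
  obtain ⟨N, hN⟩ : ∃ N, ∀ i j, (F.num i j).natDegree < N :=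
    ⟨(Finset.univ.sup fun x : Fin n × Fin n => (F.num x.1 x.2).natDegree) + 1, fun i j =>
      Nat.lt_succ_of_le (Finset.le_sup (f := fun x : Fin n × Fin n => (F.num x.1 x.2).natDegree)
        (Finset.mem_univ (i, j)))⟩
  let M : ℕ → Matrix (Fin n) (Fin n) ℍ[ℝ] := fun k => F.num.map fun q => q.coeff k
  -- Convolution of the Laurent coefficients of `1/r` with the coefficients of `Q`.
  refine ⟨fun u => ∑ k ∈ Finset.range N, c (u - k) • M k, ?_, fun p => ?_⟩
  · refine Summable.of_nonneg_of_le (fun _ => norm_nonneg (quatMatrixCLM _))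
      (fun u => quatMatrixOpNorm_sum_smul_le _ _ _) (summable_sum fun k _ => ?_)
    exact ((Equiv.subRight (k : ℤ)).summable_iff.2 hc).mul_right _
  · have hp : ‖(p : ℍ[ℝ])‖ = 1 := by simp
    have hp0 : (p : ℍ[ℝ]) ≠ 0 := by
      intro h
      simp [h] at hp
    have hr := hasSum_inv_aeval_quaternion hcz hp
    have hk : ∀ k : ℕ, HasSum (fun u : ℤ => c (u - k) • (p : ℍ[ℝ]) ^ u)
        ((Polynomial.aeval (p : ℍ[ℝ]) F.den)⁻¹ * (p : ℍ[ℝ]) ^ k) := by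
      intro k
      refine ((Equiv.subRight (k : ℤ)).hasSum_iff.2
        (hr.mul_right ((p : ℍ[ℝ]) ^ k))).congr_eq (fun u => ?_) rfl
      simp only [Function.comp_apply, Equiv.subRight_apply]
      rw [smul_mul_assoc, ← zpow_natCast, ← zpow_add₀ hp0, sub_add_cancel]
    have hsum := hasSum_sum (s := Finset.range N) fun k _ => (hk k).smul_const (M k)
    refine hsum.congr_eq (fun u => ?_) ?_
    · rw [Finset.smul_sum]
      refine Finset.sum_congr rfl fun k _ => ?_
      rw [smul_comm, smul_assoc]
    · ext1 i j
      simp only [eval, Matrix.smul_apply, Matrix.map_apply, Matrix.sum_apply, smul_eq_mul, M]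
      rw [quatPolyEval_eq_sum_range _ (hN i j), Finset.mul_sum]
      simp only [mul_assoc]

end QuatRationalMatrix

/-! ### Continuity of Wiener functions and the equivalence -/

/-- Weierstrass M-test, entry by entry. -/
theorem quatWiener_exists_continuousOn {n : ℕ}
    {G : Metric.sphere (0 : ℍ[ℝ]) 1 → Matrix (Fin n) (Fin n) ℍ[ℝ]} (hG : G ∈ quatWiener n) :
    ∃ g : ℍ[ℝ] → Matrix (Fin n) (Fin n) ℍ[ℝ], ContinuousOn g (Metric.sphere 0 1) ∧
      ∀ p : Metric.sphere (0 : ℍ[ℝ]) 1, g p = G p := by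
  obtain ⟨c, hc, hG⟩ := hG
  refine ⟨fun p => Matrix.of fun i j => ∑' u, p ^ u * c u i j, ?_, fun p => ?_⟩
  · refine continuousOn_pi.2 fun i => continuousOn_pi.2 fun j => ?_
    refine continuousOn_tsum (u := fun u => quatMatrixOpNorm (c u)) (fun u => ?_) hc ?_
    · refine ContinuousOn.mul (fun p hp => ?_) continuousOn_const
      refine (continuousAt_zpow₀ p u (Or.inl ?_)).continuousWithinAt
      rintro rfl
      simp at hp
    · intro u p hp
      rw [norm_mul, norm_zpow, mem_sphere_zero_iff_norm.1 hp, one_zpow, one_mul]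
      exact norm_apply_le_quatMatrixOpNorm (c u) i j
  · ext1 i j
    exact (Pi.hasSum.1 (Pi.hasSum.1 (hG p) i) j).tsum_eq

theorem proposition5p1 (n : ℕ) (F : QuatRationalMatrix n) :
    (∀ p ∈ Metric.sphere (0 : Quaternion ℝ) 1, ¬ F.IsPole p) ↔ F.MemWiener := by
  have hcl : Metric.sphere 0 1 ⊆ closure (F.domain ∩ Metric.sphere (0 : ℍ[ℝ]) 1) := fun p hp =>
    mem_closure_sphere_aeval_ne_zero F.den_ne_zero (mem_sphere_zero_iff_norm.1 hp)
  constructor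
  · intro h
    obtain ⟨F', hF', heq⟩ := F.exists_reduced subset_rfl
      (hcl.trans (closure_mono Set.inter_subset_left)) fun p hp => not_not.1 (h p hp)
    exact ⟨_, F'.eval_mem_quatWiener hF', fun p hp => heq p hp⟩
  · rintro ⟨G, hG, hFG⟩ p hp
    obtain ⟨g, hg, hgG⟩ := quatWiener_exists_continuousOn hG
    -- Limits are known only along the sphere, whereas a pole concerns the whole domain; reduction
    -- bridges the gap.
    obtain ⟨F', hF', heq⟩ := F.exists_reduced Set.inter_subset_left hcl fun q hq => by
      refine ⟨g q, ((hg q hq).mono_left (nhdsWithin_mono _ Set.inter_subset_right)).congr' ?_⟩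
      filter_upwards [self_mem_nhdsWithin] with x hx
      rw [hFG ⟨x, hx.2⟩ hx.1, ← hgG]
    refine not_not.2 ⟨F'.eval p, ?_⟩
    refine ((F'.continuousAt_eval (hF' hp)).tendsto.mono_left nhdsWithin_le_nhds).congr' ?_
    filter_upwards [self_mem_nhdsWithin] with x hx using (heq x hx).symm
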